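/- **Theorem 2.** Let $d\ge 1$ be an integer and $\sigma>0$, let $\mathcal X=[0,1]^d$, and let $\mathcal H$ be the reproducing kernel Hilbert space on $\mathbb R^d$ of the squared exponential kernel $k(x,y)=\exp(-\|x-y\|^2/\sigma^2)$, where $\|\cdot\|$ is the Euclidean norm. For $R>0$ put $S=\{f\in\mathcal H:\|f\|_{\mathcal H}\le R\}$. A deterministic algorithm is a sequence of maps $\pi_t:(\mathcal X\times\mathbb R)^{t-1}\to\mathcal X$, $t\ge 1$; run on $f$, it evaluates $f$ at $x_t=\pi_t\big((x_\tau,f(x_\tau))_{\tau=1}^{t-1}\big)$, $t=1,2,\dots$. Its simple regret on $f$ after $T\ge 1$ evaluations is $r_{(T)}=\min_{1\le\tau\le T}f(x_\tau)-\min_{x\in\mathcal X}f(x)$. (Lower bound.) There are constants $c>0$ and $\rho>1$ that depend only on $d$ and $\sigma$ such that for all $R>0$ and $\epsilon>0$ with $R/\epsilon\ge\rho$ and every $T\ge 1$: if some deterministic algorithm has simple regret $r_{(T)}\le\epsilon$ on every $f\in S$, then $$T\ \ge\ c\,\Big(\log\frac R\epsilon\Big)^{d/2-1}.$$ (Upper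 bound.) There are constants $C>0$ and $\rho>1$ that depend only on $d$ and $\sigma$ such that for all $R>0$ and $\epsilon>0$ with $R/\epsilon\ge\rho$ there are an integer $N\ge 1$, with $$T:=N^d+1\ \le\ C\,\Big(\log\frac R\epsilon\Big)^{d},$$ and a deterministic algorithm whose first $N^d$ evaluations are, in a fixed order and without adaptation to the observed values, at the points of the grid $\{(k_1/N,\dots,k_d/N):k_i\in\{0,\dots,N-1\}\}$ (only the last evaluation point may depend on the observed values), and which has simple regret $r_{(T)}\le\epsilon$ on every $f\in S$. -/

import Mathlib

noncomputable section

/-- The feasible set `[0,1]^d` in Euclidean space. -/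
def unitCube (d : ℕ) : Set (EuclideanSpace ℝ (Fin d)) :=
  {x | ∀ i, x i ∈ Set.Icc (0 : ℝ) 1}

/-- The squared exponential kernel with length scale `σ`. -/
def seKernel {d : ℕ} (σ : ℝ) (x y : EuclideanSpace ℝ (Fin d)) : ℝ :=
  Real.exp (-(‖x - y‖ ^ 2 / σ ^ 2))

/-- The squared exponential kernel in the form used by Mathlib's theory of (vector-valued)
reproducing kernels: the number `k(x,y)` as multiplication by `k(x,y)` on `ℝ`. -/
def seKernelMatrix (d : ℕ) (σ : ℝ) :
    Matrix (EuclideanSpace ℝ (Fin d)) (EuclideanSpace ℝ (Fin d)) (ℝ →L[ℝ] ℝ) :=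
  Matrix.of fun x y => seKernel σ x y • ContinuousLinearMap.id ℝ ℝ

theorem seKernel_eq_integral {d : ℕ} (σ : ℝ) (x y : EuclideanSpace ℝ (Fin d)) :
    seKernel σ x y = ∫ ξ, Real.cos (inner ℝ ξ ((√2 / σ) • (x - y)))
      ∂(ProbabilityTheory.stdGaussian (EuclideanSpace ℝ (Fin d))) := by
  have h := ProbabilityTheory.charFun_stdGaussian ((√2 / σ) • (x - y))
  rw [MeasureTheory.charFun_apply] at h
  have h2 := congrArg Complex.re h
  have hint : MeasureTheory.Integrable (fun ξ : EuclideanSpace ℝ (Fin d) =>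
      Complex.exp (inner ℝ ξ ((√2 / σ) • (x - y)) * Complex.I))
      (ProbabilityTheory.stdGaussian (EuclideanSpace ℝ (Fin d))) := by
    refine MeasureTheory.Integrable.of_bound (C := 1) (by fun_prop) ?_
    filter_upwards with ξ
    rw [Complex.norm_exp_ofReal_mul_I]
  have h3 := integral_re hint
  simp only [RCLike.re_to_complex] at h3
  rw [← h3] at h2
  simp only [Complex.exp_ofReal_mul_I_re] at h2
  rw [h2, seKernel]
  have : (-(‖(√2 / σ) • (x - y)‖ : ℂ) ^ 2 / 2)
      = ((-(‖x - y‖ ^ 2 / σ ^ 2) : ℝ) : ℂ) := by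
    have : -‖(√2 / σ) • (x - y)‖ ^ 2 / 2 = -(‖x - y‖ ^ 2 / σ ^ 2) := by
      rw [norm_smul, mul_pow, Real.norm_eq_abs, sq_abs, div_pow, Real.sq_sqrt (by norm_num)]
      ring
    rw [← this]; push_cast; ring
  rw [this, Complex.exp_ofReal_re]

theorem seKernel_sum_nonneg {d : ℕ} (σ : ℝ) (w : EuclideanSpace ℝ (Fin d) →₀ ℝ) :
    0 ≤ ∑ x ∈ w.support, ∑ y ∈ w.support, w x * w y * seKernel σ y x := by
  have hint : ∀ v, MeasureTheory.Integrable
      (fun ξ : EuclideanSpace ℝ (Fin d) => Real.cos (inner ℝ ξ v))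
      (ProbabilityTheory.stdGaussian (EuclideanSpace ℝ (Fin d))) := fun v => by
    refine MeasureTheory.Integrable.of_bound (C := 1) (by fun_prop) ?_
    filter_upwards with ξ
    exact Real.abs_cos_le_one _
  simp only [seKernel_eq_integral, ← MeasureTheory.integral_const_mul]
  simp_rw [← MeasureTheory.integral_finsetSum _ (fun i _ => (hint _).const_mul _)]
  rw [← MeasureTheory.integral_finsetSum _ (fun i _ =>
    MeasureTheory.integrable_finsetSum _ fun j _ => (hint _).const_mul _)]
  refine MeasureTheory.integral_nonneg fun ξ => ?_
  have : ∑ x ∈ w.support, ∑ y ∈ w.support,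
        w x * w y * Real.cos (inner ℝ ξ ((√2 / σ) • (y - x)))
      = (∑ x ∈ w.support, w x * Real.cos (inner ℝ ξ ((√2 / σ) • x))) ^ 2
        + (∑ x ∈ w.support, w x * Real.sin (inner ℝ ξ ((√2 / σ) • x))) ^ 2 := by
    rw [sq, sq, Finset.sum_mul_sum, Finset.sum_mul_sum, ← Finset.sum_add_distrib]
    refine Finset.sum_congr rfl fun x _ => ?_
    rw [← Finset.sum_add_distrib]
    refine Finset.sum_congr rfl fun y _ => ?_
    rw [smul_sub, inner_sub_right, Real.cos_sub]
    ring
  simp only [Pi.zero_apply]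
  rw [this]
  positivity

instance seKernelMatrix_posSemidef (d : ℕ) (σ : ℝ) : Fact (seKernelMatrix d σ).PosSemidef where
  out := by
    have key := (RKHS.posSemidef_tfae (K := seKernelMatrix d σ)).out 0 2
    refine key.mpr ⟨?_, fun w => ?_⟩
    · ext x y
      simp [seKernelMatrix, seKernel, norm_sub_rev, ContinuousLinearMap.star_eq_adjoint]
      have hid : (ContinuousLinearMap.id ℝ ℝ).adjoint = ContinuousLinearMap.id ℝ ℝ :=
        ContinuousLinearMap.adjoint_id
      rw [hid, ContinuousLinearMap.id_apply]
    · have h := seKernel_sum_nonneg σ w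
      convert h using 1
      simp only [Finsupp.sum, seKernelMatrix, Matrix.of_apply, RCLike.re_to_real]
      refine Finset.sum_congr rfl fun x _ => Finset.sum_congr rfl fun y _ => ?_
      simp
      ring

/-- The reproducing kernel Hilbert space on `ℝ^d` of the squared exponential kernel. -/
abbrev SERKHS (d : ℕ) (σ : ℝ) : Type := RKHS.OfKernel (seKernelMatrix d σ)

/-- The restriction to `[0,1]^d` of a function of the reproducing kernel Hilbert space. -/
def SERKHS.onCube {d : ℕ} {σ : ℝ} (f : SERKHS d σ) : unitCube d → ℝ :=
  fun x => f (x : EuclideanSpace ℝ (Fin d))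

/-- A deterministic algorithm on the feasible set `X`: `next t` computes the `(t+1)`-st evaluation
point from the first `t` evaluation points and the function values observed there. -/
structure DetAlgorithm (X : Type) where
  next : (t : ℕ) → (Fin t → X × ℝ) → X

/-- The evaluation points of the algorithm when it is run on `f`, with indices starting at `0`. -/
def DetAlgorithm.query {X : Type} (A : DetAlgorithm X) (f : X → ℝ) (t : ℕ) : X :=
  A.next t fun τ : Fin t => (A.query f τ, f (A.query f τ))
termination_by t
decreasing_by exact τ.2

/-- The simple regret after `T` evaluations (meaningful for `1 ≤ T` and `f` bounded below). -/
def simpleRegret {X : Type} (A : DetAlgorithm X) (f : X → ℝ) (T : ℕ) : ℝ :=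
  (⨅ τ : Fin T, f (A.query f τ)) - ⨅ x, f x

/-- On every function of the ball of radius `R` of the reproducing kernel Hilbert space, the
algorithm reaches simple regret at most `ε` in `T` evaluations. -/
def AchievesRegret {d : ℕ} (σ R ε : ℝ) (A : DetAlgorithm (unitCube d)) (T : ℕ) : Prop :=
  ∀ f : SERKHS d σ, ‖f‖ ≤ R → simpleRegret A f.onCube T ≤ ε

/-- The points `(k₁/N, …, k_d/N)`, `kᵢ ∈ {0, …, N-1}`, of the uniform grid in `[0,1]^d`. -/
def gridPoint {d N : ℕ} (k : Fin d → Fin N) : unitCube d :=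
  ⟨WithLp.toLp 2 fun i => ((k i : ℕ) : ℝ) / N, fun i =>
    ⟨by positivity, div_le_one_of_le₀ (by exact_mod_cast (k i).2.le) (by positivity)⟩⟩

/-- The first `N ^ d` evaluations of the algorithm are at the `N ^ d` points of the uniform grid, in
a fixed order and whatever values are observed. -/
def DetAlgorithm.SamplesGridFirst {d : ℕ} (A : DetAlgorithm (unitCube d)) (N : ℕ) : Prop :=
  ∃ e : Fin (N ^ d) ≃ (Fin d → Fin N),
    ∀ (t : Fin (N ^ d)) (h : Fin t → unitCube d × ℝ), A.next t h = gridPoint (e t)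

end

/-! ### The kernel, its expansion, and point evaluation in the Hilbert space -/

noncomputable section

/-! Both bounds concern one quantity: how large a function `f` of the space can be on the cube,
relative to `‖f‖`, when it vanishes at the evaluation points.

Upper bound. If every `f` of norm at most `2R` that vanishes on the grid is at most `η` on the cube,
then any two functions of the ball with equal grid data differ by at most `η`, so nearly minimizing
one of them nearly minimizes the other. Such `f` are exponentially small in `N`. In one variable the
kernel is a sum of products of the features `exp (-s²/σ²) * s ^ n` with factorially decaying
coefficients. Lagrange interpolation at `N` nodes, twisted by the Gaussian factor, reproduces the
features with `n < N`; its weights grow like `exp (3N)`, which the tail of the series beats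
(`exists_quadrature_weights`). Applying this one coordinate at a time gives
`exists_abs_apply_le_exp_neg`, and `N` proportional to `log (R/ε)` suffices.

Lower bound. An adversary answers `0`. The kernel sections at a grid of `n ^ d` points span a space
with a dual basis of norms at most `exp (O(n²))` (`exists_dual_coefficients`). If `T < n ^ d`, some
nonzero combination vanishes at all queries, yet its value at some grid point is at least `exp
(-O(n²))` times its norm. Scaled to norm `R`, with either sign, it forces `log (R/ε) ≤ Q n²`. Taking
`n` of order `√(log (R/ε))` yields exponent `d/2`, more than the required `d/2 - 1`. -/

/-- The squared exponential kernel on the real line. -/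
def seKernelReal (σ s t : ℝ) : ℝ :=
  Real.exp (-((s - t) ^ 2 / σ ^ 2))

theorem seKernel_toLp {d : ℕ} (σ : ℝ) (u v : Fin d → ℝ) :
    seKernel σ (WithLp.toLp 2 u) (WithLp.toLp 2 v) = ∏ i, seKernelReal σ (u i) (v i) := by
  simp only [seKernel, seKernelReal, ← Real.exp_sum, EuclideanSpace.real_norm_sq_eq,
    Finset.sum_neg_distrib, Finset.sum_div]
  simp

/-- On a line parallel to an axis the kernel is the one-dimensional one, so one-dimensional
quadrature can be applied in each coordinate separately. -/
theorem seKernel_update {d : ℕ} (σ : ℝ) (v : Fin d → ℝ) (i : Fin d) (s t : ℝ) :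
    seKernel σ (WithLp.toLp 2 (Function.update v i s)) (WithLp.toLp 2 (Function.update v i t))
      = seKernelReal σ s t := by
  rw [seKernel_toLp, Finset.prod_eq_single i]
  · simp
  · intro j _ hj
    simp [hj, seKernelReal]
  · simp

theorem seKernel_comm {d : ℕ} (σ : ℝ) (x y : EuclideanSpace ℝ (Fin d)) :
    seKernel σ x y = seKernel σ y x := by
  rw [seKernel, seKernel, norm_sub_rev]

/-- The Taylor expansion of the one-dimensional kernel as a sum of products. -/
theorem hasSum_seKernelReal (σ s t : ℝ) :
    HasSum (fun n : ℕ => (2 / σ ^ 2) ^ n / n.factorial *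
      ((Real.exp (-(s ^ 2 / σ ^ 2)) * s ^ n) * (Real.exp (-(t ^ 2 / σ ^ 2)) * t ^ n)))
      (seKernelReal σ s t) := by
  have h := (NormedSpace.expSeries_div_hasSum_exp (2 / σ ^ 2 * s * t)).mul_left
    (Real.exp (-(s ^ 2 / σ ^ 2)) * Real.exp (-(t ^ 2 / σ ^ 2)))
  rw [← Real.exp_eq_exp_ℝ, ← Real.exp_add, ← Real.exp_add] at h
  convert! h using 1
  · ext n
    rw [mul_pow, mul_pow, Real.exp_add]
    ring
  · rw [seKernelReal]
    congr 1
    ring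

namespace SERKHS

variable {d : ℕ} {σ : ℝ}

/-- The function `k(·, x)` as an element of the reproducing kernel Hilbert space. -/
def kernelSection (σ : ℝ) (x : EuclideanSpace ℝ (Fin d)) : SERKHS d σ :=
  RKHS.kerFun (SERKHS d σ) x (1 : ℝ)

theorem inner_kernelSection (f : SERKHS d σ) (x : EuclideanSpace ℝ (Fin d)) :
    inner ℝ f (kernelSection σ x) = f x := by
  rw [kernelSection, RKHS.inner_kerFun]
  simp

theorem kernelSection_apply (x y : EuclideanSpace ℝ (Fin d)) :
    kernelSection σ y x = seKernel σ x y := by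
  rw [kernelSection, RKHS.kerFun_apply, RKHS.OfKernel.kernel_ofKernel]
  simp [seKernelMatrix]

theorem inner_kernelSection_kernelSection (x y : EuclideanSpace ℝ (Fin d)) :
    inner ℝ (kernelSection σ x) (kernelSection σ y) = seKernel σ x y := by
  rw [inner_kernelSection, kernelSection_apply, seKernel_comm]

theorem norm_kernelSection (x : EuclideanSpace ℝ (Fin d)) : ‖kernelSection σ x‖ = 1 := by
  have h := real_inner_self_eq_norm_sq (kernelSection σ x)
  rw [inner_kernelSection_kernelSection] at h
  have h1 : seKernel σ x x = 1 := by simp [seKernel]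
  rw [h1] at h
  nlinarith [norm_nonneg (kernelSection σ x)]

theorem abs_apply_le (f : SERKHS d σ) (x : EuclideanSpace ℝ (Fin d)) : |f x| ≤ ‖f‖ := by
  rw [← inner_kernelSection]
  simpa [norm_kernelSection] using abs_real_inner_le_norm f (kernelSection σ x)

theorem sum_apply {ι : Type*} (s : Finset ι) (f : ι → SERKHS d σ)
    (x : EuclideanSpace ℝ (Fin d)) : (∑ i ∈ s, f i) x = ∑ i ∈ s, f i x := by
  simp only [← inner_kernelSection, sum_inner]

/-- The error of a linear quadrature rule for point evaluation is controlled by a quadratic form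
of the kernel. -/
theorem sq_apply_sub_sum_le {ι : Type*} (s : Finset ι) (w : ι → ℝ)
    (p : ι → EuclideanSpace ℝ (Fin d)) (x : EuclideanSpace ℝ (Fin d)) (f : SERKHS d σ) :
    (f x - ∑ k ∈ s, w k * f (p k)) ^ 2 ≤ ‖f‖ ^ 2 *
      (seKernel σ x x - 2 * ∑ k ∈ s, w k * seKernel σ x (p k)
        + ∑ k ∈ s, ∑ l ∈ s, w k * (w l * seKernel σ (p k) (p l))) := by
  have h1 : inner ℝ f (kernelSection σ x - ∑ k ∈ s, w k • kernelSection σ (p k))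
      = f x - ∑ k ∈ s, w k * f (p k) := by
    simp only [inner_sub_right, inner_sum, real_inner_smul_right, inner_kernelSection]
  have h2 : ‖kernelSection σ x - ∑ k ∈ s, w k • kernelSection σ (p k)‖ ^ 2
      = seKernel σ x x - 2 * ∑ k ∈ s, w k * seKernel σ x (p k)
        + ∑ k ∈ s, ∑ l ∈ s, w k * (w l * seKernel σ (p k) (p l)) := by
    rw [norm_sub_sq_real, ← real_inner_self_eq_norm_sq, ← real_inner_self_eq_norm_sq]
    simp only [inner_sum, sum_inner, real_inner_smul_right, real_inner_smul_left,
      inner_kernelSection_kernelSection]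
    rw [Finset.sum_comm]
    congr 1
    exact Finset.sum_congr rfl fun k _ => Finset.sum_congr rfl fun l _ => by ring
  rw [← h1, ← h2, ← mul_pow, ← sq_abs]
  exact pow_le_pow_left₀ (abs_nonneg _) (abs_real_inner_le_norm _ _) 2

end SERKHS

end

/-! ### Interpolation at equispaced nodes -/

noncomputable section

/-- The indices below `k` contribute `k!`, those above `k` contribute `(N - 1 - k)!`. -/
theorem prod_abs_sub_range_erase {k N : ℕ} (hk : k < N) :
    ∏ j ∈ (Finset.range N).erase k, |(k : ℝ) - j| = k.factorial * (N - 1 - k).factorial := by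
  induction N, Nat.succ_le_of_lt hk using Nat.le_induction with
  | base =>
    rw [Finset.range_add_one, Finset.erase_insert (by simp)]
    simp only [Nat.succ_eq_add_one, Nat.add_sub_cancel, Nat.sub_self, Nat.factorial_zero,
      Nat.cast_one, mul_one]
    rw [← Finset.prod_range_add_one_eq_factorial, ← Finset.prod_range_reflect, Nat.cast_prod]
    refine Finset.prod_congr rfl fun j hj => ?_
    have hj' := Finset.mem_range.mp hj
    have hk' : (k : ℝ) = ((k - 1 - j : ℕ) : ℝ) + ((j + 1 : ℕ) : ℝ) := by
      exact_mod_cast (by omega : k = k - 1 - j + (j + 1))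
    rw [hk', add_sub_cancel_left, Nat.abs_cast]
  | succ n hn ih =>
    have hkn : k < n := hn
    rw [Finset.range_add_one, Finset.erase_insert_of_ne (by omega), Finset.prod_insert (by simp),
      ih hkn, show n + 1 - 1 - k = (n - 1 - k) + 1 by omega, Nat.factorial_succ,
      show n - 1 - k + 1 = n - k by omega, abs_sub_comm, abs_of_nonneg, Nat.cast_mul,
      Nat.cast_sub hkn.le]
    · ring
    · exact sub_nonneg.mpr (by exact_mod_cast hkn.le)

/-- Lagrange basis polynomials of the nodes `0, 1/N, …, (N-1)/N` grow at most exponentially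
in `N` on the unit interval. -/
theorem abs_eval_lagrange_basis_le {k N : ℕ} (hk : k < N) {t : ℝ} (ht : t ∈ Set.Icc (0 : ℝ) 1) :
    |(Lagrange.basis (Finset.range N) (fun j : ℕ => (j : ℝ) / N) k).eval t|
      ≤ Real.exp (2 * N) := by
  have hN : (0 : ℝ) < N := by exact_mod_cast (by omega : 0 < N)
  have hcard : ((Finset.range N).erase k).card = N - 1 := by
    rw [Finset.card_erase_of_mem (Finset.mem_range.mpr hk), Finset.card_range]
  have h1 : |(Lagrange.basis (Finset.range N) (fun j : ℕ => (j : ℝ) / N) k).eval t|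
      ≤ ∏ j ∈ (Finset.range N).erase k, (N * |(k : ℝ) - j|⁻¹) := by
    rw [Lagrange.basis, Polynomial.eval_prod, Finset.abs_prod]
    refine Finset.prod_le_prod (fun _ _ => abs_nonneg _) fun j hj => ?_
    have hjN : j < N := Finset.mem_range.mp (Finset.mem_of_mem_erase hj)
    simp only [Lagrange.basisDivisor, Polynomial.eval_mul, Polynomial.eval_C, Polynomial.eval_sub,
      Polynomial.eval_X, abs_mul, ← sub_div, inv_div, abs_div, Nat.abs_cast]
    rw [div_eq_mul_inv]
    refine mul_le_of_le_one_right (by positivity) ?_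
    have hj0 : (0 : ℝ) ≤ (j : ℝ) / N := by positivity
    have hj1 : (j : ℝ) / N ≤ 1 := div_le_one_of_le₀ (by exact_mod_cast hjN.le) hN.le
    rw [abs_le]
    constructor <;> linarith [ht.1, ht.2]
  refine h1.trans ?_
  rw [Finset.prod_mul_distrib, Finset.prod_const, hcard, Finset.prod_inv_distrib,
    prod_abs_sub_range_erase hk]
  have hfac : (((N - 1).choose k : ℕ) : ℝ) * k.factorial * (N - 1 - k).factorial
      = (N - 1).factorial := by
    exact_mod_cast Nat.choose_mul_factorial_mul_factorial (by omega : k ≤ N - 1)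
  have hfN : (N.factorial : ℝ) = N * (N - 1).factorial := by
    exact_mod_cast (Nat.mul_factorial_pred (by omega)).symm
  have hp : (N : ℝ) ^ N = N * N ^ (N - 1) := by
    rw [← pow_succ', Nat.sub_add_cancel (by omega)]
  -- Rewritten so that the two factors are bounded separately: `N ^ N / N! ≤ exp N`, and a binomial
  -- coefficient is at most `2 ^ N ≤ exp N`.
  have h2 : (N : ℝ) ^ (N - 1) * ((k.factorial : ℝ) * (N - 1 - k).factorial)⁻¹
      = N ^ N / N.factorial * (N - 1).choose k := by
    rw [hp, hfN, ← hfac]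
    have hc : (((N - 1).choose k : ℕ) : ℝ) ≠ 0 := by
      exact_mod_cast (Nat.choose_pos (by omega)).ne'
    field_simp
  have h3 : (((N - 1).choose k : ℕ) : ℝ) ≤ Real.exp N := by
    have : (N - 1).choose k ≤ 2 ^ N := (Nat.choose_le_two_pow _ _).trans
      (Nat.pow_le_pow_right (by norm_num) (by omega))
    calc (((N - 1).choose k : ℕ) : ℝ) ≤ (2 : ℝ) ^ N := by exact_mod_cast this
      _ ≤ Real.exp 1 ^ N := by
        gcongr
        linarith [Real.add_one_le_exp 1]
      _ = Real.exp N := by rw [← Real.exp_nat_mul, mul_one]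
  rw [h2, two_mul, Real.exp_add]
  exact mul_le_mul (Real.pow_div_factorial_le_exp _ hN.le N) h3 (by positivity) (by positivity)

/-- Interpolation with `N` nodes is exact in degree below `N`. -/
theorem sum_pow_mul_eval_lagrange_basis {N n : ℕ} (hn : n < N) (t : ℝ) :
    ∑ k ∈ Finset.range N, (Lagrange.basis (Finset.range N) (fun j : ℕ => (j : ℝ) / N) k).eval t *
      ((k : ℝ) / N) ^ n = t ^ n := by
  have hN : (N : ℝ) ≠ 0 := by exact_mod_cast (by omega : N ≠ 0)
  have hinj : Set.InjOn (fun j : ℕ => (j : ℝ) / N) (Finset.range N) := fun a _ b _ hab => by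
    have hab' : (a : ℝ) / N = (b : ℝ) / N := hab
    rw [div_left_inj' hN] at hab'
    exact_mod_cast hab'
  have h := Lagrange.eq_interpolate (f := (Polynomial.X ^ n : Polynomial ℝ)) hinj
    (by rw [Polynomial.degree_X_pow, Finset.card_range]; exact_mod_cast hn)
  have h2 := congrArg (Polynomial.eval t) h
  rw [Lagrange.interpolate_apply, Polynomial.eval_finsetSum] at h2
  simp only [Polynomial.eval_mul, Polynomial.eval_C, Polynomial.eval_pow, Polynomial.eval_X] at h2
  rw [h2]
  exact Finset.sum_congr rfl fun k _ => mul_comm _ _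

/-- For every `q`, there are quadrature weights on the `N` equispaced nodes that reproduce the
evaluation at `t` in the one-dimensional space up to an error of order `exp ((3 - q / 2) * N)`. -/
theorem exists_quadrature_weights (σ q : ℝ) (hq : 0 ≤ q) (N : ℕ) {t : ℝ}
    (ht : t ∈ Set.Icc (0 : ℝ) 1) :
    ∃ w : ℕ → ℝ,
      ∑ k ∈ Finset.range N, |w k| ≤ Real.exp (1 / σ ^ 2) * Real.exp (3 * N) ∧
      seKernelReal σ t t - 2 * ∑ k ∈ Finset.range N, w k * seKernelReal σ t ((k : ℝ) / N)
        + ∑ k ∈ Finset.range N, ∑ l ∈ Finset.range N,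
            w k * (w l * seKernelReal σ ((k : ℝ) / N) ((l : ℝ) / N))
        ≤ (2 * Real.exp (3 * N)) ^ 2 * Real.exp (-(q * N)) *
            Real.exp (2 / σ ^ 2 * Real.exp q) := by
  set b : ℕ → ℝ := fun k =>
    (Lagrange.basis (Finset.range N) (fun j : ℕ => (j : ℝ) / N) k).eval t with hb
  have hnode : ∀ k ∈ Finset.range N, (k : ℝ) / N ∈ Set.Icc (0 : ℝ) 1 := fun k hk =>
    ⟨by positivity, div_le_one_of_le₀ (by exact_mod_cast (Finset.mem_range.mp hk).le)
      (by positivity)⟩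
  have hbsum : ∑ k ∈ Finset.range N, |b k| ≤ Real.exp (3 * N) := by
    calc ∑ k ∈ Finset.range N, |b k| ≤ ∑ k ∈ Finset.range N, Real.exp (2 * N) :=
          Finset.sum_le_sum fun k hk => abs_eval_lagrange_basis_le (Finset.mem_range.mp hk) ht
      _ = N * Real.exp (2 * N) := by simp
      _ ≤ Real.exp N * Real.exp (2 * N) := by
        gcongr
        linarith [Real.add_one_le_exp (N : ℝ)]
      _ = Real.exp (3 * N) := by rw [← Real.exp_add]; ring_nf
  -- Lagrange values conjugated by the Gaussian factor, so that features are reproduced exactly when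
  -- monomials are.
  refine ⟨fun k => Real.exp (-(t ^ 2 / σ ^ 2)) * Real.exp (((k : ℝ) / N) ^ 2 / σ ^ 2) * b k,
    ?_, ?_⟩
  · refine le_trans (Finset.sum_le_sum fun k hk => ?_)
      ((Finset.mul_sum _ _ _).symm.le.trans
        (mul_le_mul_of_nonneg_left hbsum (Real.exp_pos (1 / σ ^ 2)).le))
    rw [abs_mul, abs_of_pos (by positivity)]
    gcongr
    calc Real.exp (-(t ^ 2 / σ ^ 2)) * Real.exp (((k : ℝ) / N) ^ 2 / σ ^ 2)
        ≤ 1 * Real.exp (((k : ℝ) / N) ^ 2 / σ ^ 2) := by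
          gcongr
          exact Real.exp_le_one_iff.mpr (neg_nonpos.mpr (by positivity))
      _ ≤ Real.exp (1 / σ ^ 2) := by
          rw [one_mul]
          gcongr
          exact pow_le_one₀ (hnode k hk).1 (hnode k hk).2
  · set w : ℕ → ℝ :=
      fun k => Real.exp (-(t ^ 2 / σ ^ 2)) * Real.exp (((k : ℝ) / N) ^ 2 / σ ^ 2) * b k with hw
    set φ : ℝ → ℕ → ℝ := fun s n => Real.exp (-(s ^ 2 / σ ^ 2)) * s ^ n with hφ
    set c : ℕ → ℝ := fun n => (2 / σ ^ 2) ^ n / n.factorial with hc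
    -- The feature expansion turns the quadratic form into a weighted sum of squared interpolation
    -- residuals; those with `n < N` vanish.
    have hsum : HasSum (fun n => c n * (φ t n - ∑ k ∈ Finset.range N, w k * φ ((k : ℝ) / N) n) ^ 2)
        (seKernelReal σ t t - 2 * ∑ k ∈ Finset.range N, w k * seKernelReal σ t ((k : ℝ) / N)
        + ∑ k ∈ Finset.range N, ∑ l ∈ Finset.range N,
            w k * (w l * seKernelReal σ ((k : ℝ) / N) ((l : ℝ) / N))) := by
      have h := ((hasSum_seKernelReal σ t t).sub ((hasSum_sum (s := Finset.range N) fun k _ =>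
        (hasSum_seKernelReal σ t ((k : ℝ) / N)).mul_left (w k)).mul_left 2)).add
        (hasSum_sum (s := Finset.range N) fun k _ => hasSum_sum (s := Finset.range N) fun l _ =>
        ((hasSum_seKernelReal σ ((k : ℝ) / N) ((l : ℝ) / N)).mul_left (w l)).mul_left (w k))
      convert! h using 1
      ext n
      change _ = c n * (φ t n * φ t n)
        - 2 * ∑ k ∈ Finset.range N, w k * (c n * (φ t n * φ ((k : ℝ) / N) n))
        + ∑ k ∈ Finset.range N, ∑ l ∈ Finset.range N,
          w k * (w l * (c n * (φ ((k : ℝ) / N) n * φ ((l : ℝ) / N) n)))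
      have e1 : ∑ k ∈ Finset.range N, w k * (c n * (φ t n * φ ((k : ℝ) / N) n))
          = c n * φ t n * ∑ k ∈ Finset.range N, w k * φ ((k : ℝ) / N) n := by
        rw [Finset.mul_sum]
        exact Finset.sum_congr rfl fun k _ => by ring
      have e2 : ∑ k ∈ Finset.range N, ∑ l ∈ Finset.range N,
          w k * (w l * (c n * (φ ((k : ℝ) / N) n * φ ((l : ℝ) / N) n)))
          = c n * ((∑ k ∈ Finset.range N, w k * φ ((k : ℝ) / N) n) *
            ∑ k ∈ Finset.range N, w k * φ ((k : ℝ) / N) n) := by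
        rw [Finset.sum_mul_sum, Finset.mul_sum]
        refine Finset.sum_congr rfl fun k _ => ?_
        rw [Finset.mul_sum]
        exact Finset.sum_congr rfl fun l _ => by ring
      rw [e1, e2]
      ring
    have hdom : HasSum (fun n : ℕ => (2 * Real.exp (3 * N)) ^ 2 * Real.exp (-(q * N)) *
        ((2 / σ ^ 2 * Real.exp q) ^ n / n.factorial))
        ((2 * Real.exp (3 * N)) ^ 2 * Real.exp (-(q * N)) *
            Real.exp (2 / σ ^ 2 * Real.exp q)) := by
      have h := NormedSpace.expSeries_div_hasSum_exp (2 / σ ^ 2 * Real.exp q)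
      rw [← Real.exp_eq_exp_ℝ] at h
      exact h.mul_left _
    refine hasSum_le (fun n => ?_) hsum hdom
    have hres : φ t n - ∑ k ∈ Finset.range N, w k * φ ((k : ℝ) / N) n
        = Real.exp (-(t ^ 2 / σ ^ 2)) * (t ^ n - ∑ k ∈ Finset.range N, b k * ((k : ℝ) / N) ^ n) := by
      rw [mul_sub, Finset.mul_sum]
      congr 1
      refine Finset.sum_congr rfl fun k _ => ?_
      simp only [hw, hφ, Real.exp_neg (((k : ℝ) / N) ^ 2 / σ ^ 2)]
      field_simp
    rw [hres]
    rcases lt_or_ge n N with hn | hn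
    · rw [sum_pow_mul_eval_lagrange_basis hn t, sub_self, mul_zero, zero_pow two_ne_zero, mul_zero]
      positivity
    · have habs : |Real.exp (-(t ^ 2 / σ ^ 2)) *
          (t ^ n - ∑ k ∈ Finset.range N, b k * ((k : ℝ) / N) ^ n)| ≤ 2 * Real.exp (3 * N) := by
        rw [abs_mul, abs_of_pos (Real.exp_pos _)]
        refine le_trans (mul_le_of_le_one_left (abs_nonneg _)
          (Real.exp_le_one_iff.mpr (neg_nonpos.mpr (by positivity)))) ?_
        have h1 : |t ^ n| ≤ 1 := by
          rw [abs_of_nonneg (pow_nonneg ht.1 n)]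
          exact pow_le_one₀ ht.1 ht.2
        have h2 : |∑ k ∈ Finset.range N, b k * ((k : ℝ) / N) ^ n| ≤ Real.exp (3 * N) := by
          refine (Finset.abs_sum_le_sum_abs _ _).trans
            ((Finset.sum_le_sum fun k hk => ?_).trans hbsum)
          rw [abs_mul]
          refine mul_le_of_le_one_right (abs_nonneg _) ?_
          rw [abs_of_nonneg (pow_nonneg (hnode k hk).1 n)]
          exact pow_le_one₀ (hnode k hk).1 (hnode k hk).2
        have h3 : 1 ≤ Real.exp (3 * N) := Real.one_le_exp (by positivity)
        exact (abs_sub _ _).trans (by linarith)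
      have hsq := pow_le_pow_left₀ (abs_nonneg _) habs 2
      rw [sq_abs] at hsq
      -- Chernoff's trick: for `n ≥ N`, inserting `exp (q * (n - N)) ≥ 1` bounds the tail by `exp
      -- (-(q * N))` times a full exponential series.
      have hexp : 1 ≤ Real.exp (-(q * N)) * Real.exp q ^ n := by
        rw [← Real.exp_nat_mul, ← Real.exp_add]
        refine Real.one_le_exp ?_
        have : (N : ℝ) ≤ n := by exact_mod_cast hn
        nlinarith
      calc c n * _ ≤ c n * (2 * Real.exp (3 * N)) ^ 2 :=
            mul_le_mul_of_nonneg_left hsq (by positivity)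
        _ ≤ c n * (2 * Real.exp (3 * N)) ^ 2 * (Real.exp (-(q * N)) * Real.exp q ^ n) :=
            le_mul_of_one_le_right (by positivity) hexp
        _ = _ := by
            simp only [hc, mul_pow]
            ring

/-! ### Smallness of functions vanishing on the grid -/

namespace SERKHS

variable {d : ℕ} {σ : ℝ}

/-- A function of the space that vanishes on the uniform grid is small on the unit cube. -/
theorem abs_apply_le_of_grid_eq_zero (f : SERKHS d σ) {N : ℕ} {q : ℝ} (hq : 0 ≤ q)
    (hf : ∀ k : Fin d → Fin N, f (gridPoint k : EuclideanSpace ℝ (Fin d)) = 0)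
    (s : Finset (Fin d)) (v : Fin d → ℝ) (hv : ∀ i, v i ∈ Set.Icc (0 : ℝ) 1)
    (hs : ∀ i ∉ s, ∃ k : Fin N, v i = ((k : ℕ) : ℝ) / N) :
    |f (WithLp.toLp 2 v)| ≤ ‖f‖ * (2 * Real.exp (3 * N) * Real.exp (-(q * N) / 2) *
      Real.exp (2 / σ ^ 2 * Real.exp q / 2)) *
        (1 + Real.exp (1 / σ ^ 2) * Real.exp (3 * N)) ^ s.card := by
  set E := 2 * Real.exp (3 * N) * Real.exp (-(q * N) / 2) *
      Real.exp (2 / σ ^ 2 * Real.exp q / 2) with hE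
  set M := Real.exp (1 / σ ^ 2) * Real.exp (3 * N) with hM
  have hM0 : 0 < M := by positivity
  have hE0 : 0 < E := by positivity
  have hEsq : (2 * Real.exp (3 * N)) ^ 2 * Real.exp (-(q * N)) *
      Real.exp (2 / σ ^ 2 * Real.exp q) = E ^ 2 := by
    have hhalf : ∀ u : ℝ, Real.exp u = Real.exp (u / 2) ^ 2 := fun u => by
      rw [← Real.exp_nat_mul]
      congr 1
      push_cast
      ring
    rw [hE, hhalf (-(q * N)), hhalf (2 / σ ^ 2 * Real.exp q)]
    ring
  -- The set `s` holds the coordinates not yet known to lie on the grid. Freeing one more costs a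
  -- quadrature error `‖f‖ * E` plus `M` times the previous bound.
  induction s using Finset.induction_on generalizing v with
  | empty =>
    choose k hk using fun i => hs i (by simp)
    have : v = fun i => ((k i : ℕ) : ℝ) / N := funext hk
    rw [this, show f (WithLp.toLp 2 fun i => ((k i : ℕ) : ℝ) / N) = 0 from hf k, abs_zero]
    positivity
  | insert i s hi ih =>
    obtain ⟨w, hw, hquad⟩ := exists_quadrature_weights σ q hq N (hv i)
    have h1 := sq_apply_sub_sum_le (Finset.range N) w
      (fun k => WithLp.toLp 2 (Function.update v i ((k : ℝ) / N)))
      (WithLp.toLp 2 (Function.update v i (v i))) f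
    simp only [seKernel_update] at h1
    rw [Function.update_eq_self] at h1
    have h2 := h1.trans (mul_le_mul_of_nonneg_left hquad (sq_nonneg ‖f‖))
    rw [hEsq, ← mul_pow] at h2
    have h3 := abs_le_of_sq_le_sq h2 (by positivity)
    have h4 : |∑ k ∈ Finset.range N, w k * f (WithLp.toLp 2 (Function.update v i ((k : ℝ) / N)))|
        ≤ M * (‖f‖ * E * (1 + M) ^ s.card) := by
      refine (Finset.abs_sum_le_sum_abs _ _).trans (le_trans (Finset.sum_le_sum fun k hk => ?_)
        ((Finset.sum_mul _ _ _).symm.le.trans (mul_le_mul_of_nonneg_right hw (by positivity))))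
      rw [abs_mul]
      refine mul_le_mul_of_nonneg_left (ih _ (fun j => ?_) fun j hj => ?_) (abs_nonneg _)
      · rcases eq_or_ne j i with rfl | hji
        · rw [Function.update_self]
          exact ⟨by positivity, div_le_one_of_le₀
            (by exact_mod_cast (Finset.mem_range.mp hk).le) (by positivity)⟩
        · rw [Function.update_of_ne hji]
          exact hv j
      · rcases eq_or_ne j i with rfl | hji
        · exact ⟨⟨k, Finset.mem_range.mp hk⟩, by simp⟩
        · rw [Function.update_of_ne hji]
          exact hs j (by simp [hji, hj])
    have h5 : |f (WithLp.toLp 2 v)| ≤ ‖f‖ * E + M * (‖f‖ * E * (1 + M) ^ s.card) := by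
      have := abs_le.mp h3
      have := abs_le.mp h4
      rw [abs_le]
      constructor <;> linarith
    refine h5.trans ?_
    rw [Finset.card_insert_of_notMem hi, pow_succ]
    have h6 : 1 ≤ (1 + M) ^ s.card := one_le_pow₀ (by linarith)
    have h7 : 0 ≤ ‖f‖ * E := by positivity
    nlinarith

/-- Functions of the space that vanish on the uniform grid with `N ^ d` points are exponentially
small in `N` on the unit cube. -/
theorem exists_abs_apply_le_exp_neg (d : ℕ) (σ : ℝ) :
    ∃ C ≥ (1 : ℝ), ∀ (N : ℕ) (f : SERKHS d σ),
      (∀ k : Fin d → Fin N, f (gridPoint k : EuclideanSpace ℝ (Fin d)) = 0) →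
      ∀ x : unitCube d, |f (x : EuclideanSpace ℝ (Fin d))| ≤ C * Real.exp (-N) * ‖f‖ := by
  -- The error carries `exp (-(q * N) / 2)`. Half of `q` pays `3` for the residual bound and `3 * d`
  -- for the weights in `d` coordinates; the final `1` leaves `exp (-N)`.
  set q : ℝ := 2 * (3 + 3 * d + 1) with hq
  refine ⟨2 * Real.exp (2 / σ ^ 2 * Real.exp q / 2) * (2 * Real.exp (1 / σ ^ 2)) ^ d, ?_,
    fun N f hf x => ?_⟩
  · have h1 : 1 ≤ Real.exp (2 / σ ^ 2 * Real.exp q / 2) := Real.one_le_exp (by positivity)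
    have h2 : 1 ≤ (2 * Real.exp (1 / σ ^ 2)) ^ d :=
      one_le_pow₀ (by linarith [Real.one_le_exp (show (0 : ℝ) ≤ 1 / σ ^ 2 by positivity)])
    nlinarith
  · have h := abs_apply_le_of_grid_eq_zero f (q := q) (by positivity) hf Finset.univ
      (WithLp.ofLp (x : EuclideanSpace ℝ (Fin d))) x.2 (by simp)
    refine h.trans ?_
    rw [Finset.card_univ, Fintype.card_fin]
    have h1 : 1 ≤ Real.exp (1 / σ ^ 2) * Real.exp (3 * N) := by
      rw [← Real.exp_add]
      exact Real.one_le_exp (by positivity)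
    have h2 : (1 + Real.exp (1 / σ ^ 2) * Real.exp (3 * N)) ^ d
        ≤ (2 * Real.exp (1 / σ ^ 2)) ^ d * Real.exp (3 * N) ^ d := by
      rw [← mul_pow]
      exact pow_le_pow_left₀ (by positivity) (by linarith) d
    have h3 : Real.exp (3 * N) * Real.exp (-(q * N) / 2) * Real.exp (3 * N) ^ d
        = Real.exp (-N) := by
      rw [← Real.exp_nat_mul, ← Real.exp_add, ← Real.exp_add, hq]
      congr 1
      ring
    rw [← h3]
    refine (mul_le_mul_of_nonneg_left h2 (by positivity)).trans (le_of_eq ?_)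
    ring

end SERKHS

end

/-! ### Dual bases of kernel sections and functions that fool the algorithm -/

noncomputable section

/-- Multiplication by `X` only shifts coefficients, so it does not increase their truncated absolute
sum. -/
theorem sum_abs_coeff_C_mul_X_sub_C_mul_le (p : Polynomial ℝ) (a z : ℝ) (m : ℕ) :
    ∑ j ∈ Finset.range m, |(Polynomial.C a * (Polynomial.X - Polynomial.C z) * p).coeff j|
      ≤ |a| * (1 + |z|) * ∑ j ∈ Finset.range m, |p.coeff j| := by
  have hX : ∑ j ∈ Finset.range m, |(Polynomial.X * p).coeff j|
      ≤ ∑ j ∈ Finset.range m, |p.coeff j| := by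
    cases m with
    | zero => simp
    | succ m =>
      rw [Finset.sum_range_succ', Finset.sum_range_succ (fun j => |p.coeff j|)]
      simp
  calc ∑ j ∈ Finset.range m, |(Polynomial.C a * (Polynomial.X - Polynomial.C z) * p).coeff j|
      ≤ ∑ j ∈ Finset.range m, |a| * (|(Polynomial.X * p).coeff j| + |z| * |p.coeff j|) := by
        refine Finset.sum_le_sum fun j _ => ?_
        rw [mul_assoc, Polynomial.coeff_C_mul, abs_mul, sub_mul, Polynomial.coeff_sub,
          Polynomial.coeff_C_mul, ← abs_mul z]
        exact mul_le_mul_of_nonneg_left (abs_sub _ _) (abs_nonneg _)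
    _ = |a| * (∑ j ∈ Finset.range m, |(Polynomial.X * p).coeff j|
          + |z| * ∑ j ∈ Finset.range m, |p.coeff j|) := by
        rw [← Finset.mul_sum, Finset.sum_add_distrib, ← Finset.mul_sum]
    _ ≤ |a| * (∑ j ∈ Finset.range m, |p.coeff j|
          + |z| * ∑ j ∈ Finset.range m, |p.coeff j|) := by gcongr
    _ = _ := by ring

theorem sum_abs_coeff_prod_basisDivisor_le {ι : Type*} [DecidableEq ι] (s : Finset ι) (x : ℝ)
    (z : ι → ℝ) (m : ℕ) :
    ∑ j ∈ Finset.range m, |(∏ i ∈ s, Lagrange.basisDivisor x (z i)).coeff j|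
      ≤ ∏ i ∈ s, (|(x - z i)⁻¹| * (1 + |z i|)) := by
  induction s using Finset.induction_on with
  | empty =>
    rw [Finset.prod_empty, Finset.prod_empty]
    cases m with
    | zero => simp
    | succ m => simp [Finset.sum_range_succ', Polynomial.coeff_one]
  | insert i s hi ih =>
    rw [Finset.prod_insert hi, Finset.prod_insert hi, Lagrange.basisDivisor]
    exact (sum_abs_coeff_C_mul_X_sub_C_mul_le _ _ _ _).trans
      (mul_le_mul_of_nonneg_left ih (by positivity))

/-- The exponential has slope at least `1` on the nonnegative half-line. This keeps the
exponentiated nodes separated. -/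
theorem abs_sub_le_abs_exp_sub_exp {a b : ℝ} (ha : 0 ≤ a) (hb : 0 ≤ b) :
    |a - b| ≤ |Real.exp a - Real.exp b| := by
  wlog hab : b ≤ a generalizing a b
  · rw [abs_sub_comm, abs_sub_comm (Real.exp a)]
    exact this hb ha (le_of_not_ge hab)
  have h1 : Real.exp a = Real.exp b * Real.exp (a - b) := by rw [← Real.exp_add]; ring_nf
  have h2 := Real.add_one_le_exp (a - b)
  have h3 := Real.one_le_exp hb
  rw [abs_of_nonneg (sub_nonneg.mpr hab), abs_of_nonneg (sub_nonneg.mpr (Real.exp_le_exp.mpr hab)),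
    h1]
  nlinarith

/-- Up to row and column factors, the kernel matrix of equispaced nodes is a Vandermonde matrix, so
Lagrange basis polynomials invert it. -/
theorem seKernelReal_eq_mul_pow (σ x : ℝ) (n j : ℕ) :
    seKernelReal σ x ((j : ℝ) / n) = Real.exp (-(x ^ 2 / σ ^ 2)) *
      Real.exp (-(((j : ℝ) / n) ^ 2 / σ ^ 2)) * Real.exp (2 * x / (n * σ ^ 2)) ^ j := by
  rw [seKernelReal, ← Real.exp_nat_mul, ← Real.exp_add, ← Real.exp_add]
  congr 1
  ring

/-- The dual basis of the one-dimensional kernel sections at `n` equispaced nodes, with a bound on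
its coefficients. -/
theorem exists_dual_coefficients {σ : ℝ} (hσ : 0 < σ) :
    ∃ Q > (0 : ℝ), ∀ n : ℕ, ∀ k : Fin n, ∃ a : Fin n → ℝ,
      (∀ m : Fin n, ∑ j, a j * seKernelReal σ ((m : ℕ) / n : ℝ) ((j : ℕ) / n : ℝ)
        = if m = k then 1 else 0) ∧
      ∑ j, |a j| ≤ Real.exp (Q * n ^ 2) := by
  set D : ℝ := σ ^ 2 * Real.exp (2 / σ ^ 2) with hD
  -- The term `2 / σ ^ 2` pays for the two Gaussian factors, `D + 2` for the coefficients of the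
  -- Lagrange polynomial.
  refine ⟨2 / σ ^ 2 + (D + 2), by positivity, fun n k => ?_⟩
  have hn : 0 < n := k.pos
  have hn0 : (0 : ℝ) < n := by exact_mod_cast hn
  have hn1 : (1 : ℝ) ≤ n := by exact_mod_cast hn
  set y : ℕ → ℝ := fun m => 2 * ((m : ℝ) / n) / (n * σ ^ 2) with hy
  set z : ℕ → ℝ := fun m => Real.exp (y m) with hz
  have hyinj : ∀ a b : ℕ, a ≠ b → 2 / (n ^ 2 * σ ^ 2) ≤ |y a - y b| := fun a b hab => by
    have h1 : y a - y b = 2 / (n ^ 2 * σ ^ 2) * ((a : ℝ) - b) := by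
      simp only [hy]
      field_simp
    have h2 : (1 : ℝ) ≤ |(a : ℝ) - b| := by
      have h3 : (1 : ℤ) ≤ |(a : ℤ) - b| := Int.one_le_abs (by omega)
      exact_mod_cast h3
    rw [h1, abs_mul, abs_of_pos (by positivity)]
    exact le_mul_of_one_le_right (by positivity) h2
  have hzsub : ∀ a b : ℕ, a ≠ b → 2 / (n ^ 2 * σ ^ 2) ≤ |z a - z b| := fun a b hab =>
    (hyinj a b hab).trans (abs_sub_le_abs_exp_sub_exp (by positivity) (by positivity))
  have hzinj : Set.InjOn z (Finset.range n) := fun a _ b _ hab => by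
    by_contra hne
    have h1 := hzsub a b hne
    rw [hab, sub_self, abs_zero] at h1
    exact absurd h1 (not_le.mpr (by positivity))
  set p : Polynomial ℝ := Lagrange.basis (Finset.range n) z k with hp
  have hkmem : (k : ℕ) ∈ Finset.range n := Finset.mem_range.mpr k.2
  have hpdeg : p.natDegree < n := by
    rw [hp, Lagrange.natDegree_basis hzinj hkmem, Finset.card_range]
    omega
  have hnode : ∀ j : ℕ, j < n → ((j : ℝ) / n) ^ 2 / σ ^ 2 ≤ 1 / σ ^ 2 := fun j hj => by
    gcongr
    exact pow_le_one₀ (by positivity) (div_le_one_of_le₀ (by exact_mod_cast hj.le) hn0.le)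
  -- Coefficients of the Lagrange polynomial at the nodes `z`, rescaled to undo the row and column
  -- factors of the Vandermonde form.
  refine ⟨fun j => Real.exp (((k : ℕ) / n : ℝ) ^ 2 / σ ^ 2) *
    Real.exp (((j : ℕ) / n : ℝ) ^ 2 / σ ^ 2) * p.coeff j, fun m => ?_, ?_⟩
  · have h1 : ∀ j : Fin n, Real.exp (((k : ℕ) / n : ℝ) ^ 2 / σ ^ 2) *
        Real.exp (((j : ℕ) / n : ℝ) ^ 2 / σ ^ 2) * p.coeff j *
        seKernelReal σ ((m : ℕ) / n : ℝ) ((j : ℕ) / n : ℝ)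
        = Real.exp (((k : ℕ) / n : ℝ) ^ 2 / σ ^ 2) * Real.exp (-(((m : ℕ) / n : ℝ) ^ 2 / σ ^ 2)) *
          (p.coeff j * z m ^ (j : ℕ)) := fun j => by
      rw [seKernelReal_eq_mul_pow, Real.exp_neg (((j : ℕ) / n : ℝ) ^ 2 / σ ^ 2),
        show Real.exp (2 * ((m : ℕ) / n : ℝ) / (n * σ ^ 2)) = z m from rfl]
      field_simp
    rw [Finset.sum_congr rfl fun j _ => h1 j, ← Finset.mul_sum,
      ← Finset.sum_range fun j => p.coeff j * z m ^ j, ← Polynomial.eval_eq_sum_range' hpdeg]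
    split_ifs with hmk
    · rw [hmk, hp, Lagrange.eval_basis_self hzinj hkmem, mul_one, ← Real.exp_add, add_neg_cancel,
        Real.exp_zero]
    · rw [hp, Lagrange.eval_basis_of_ne (fun h => hmk (Fin.ext h.symm))
        (Finset.mem_range.mpr m.2), mul_zero]
  -- Node separation makes each factor at most `D * n ^ 2`; the cruder `exp ((D + 2) * n)` still
  -- gives `exp (O(n²))` for the product of `n - 1` factors.
  · have hfac : ∀ i ∈ (Finset.range n).erase k, |(z k - z i)⁻¹| * (1 + |z i|)
        ≤ Real.exp ((D + 2) * n) := fun i hi => by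
      have hik : (k : ℕ) ≠ i := fun h => (Finset.mem_erase.mp hi).1 h.symm
      have hin : i < n := Finset.mem_range.mp (Finset.mem_of_mem_erase hi)
      have h1 : |(z k - z i)⁻¹| ≤ (2 / (n ^ 2 * σ ^ 2))⁻¹ := by
        rw [abs_inv]
        exact inv_anti₀ (by positivity) (hzsub _ _ hik)
      have h2 : 1 + |z i| ≤ 2 * Real.exp (2 / σ ^ 2) := by
        have h3 : y i ≤ 2 / σ ^ 2 := by
          have h4 : ((i : ℝ) / n) / n ≤ 1 := div_le_one_of_le₀
            ((div_le_one_of_le₀ (by exact_mod_cast hin.le) hn0.le).trans hn1) hn0.le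
          have h5 : y i = ((i : ℝ) / n) / n * (2 / σ ^ 2) := by
            simp only [hy]
            field_simp
          rw [h5]
          exact mul_le_of_le_one_left (by positivity) h4
        have h6 : z i ≤ Real.exp (2 / σ ^ 2) := Real.exp_le_exp.mpr h3
        have h7 : 1 ≤ Real.exp (2 / σ ^ 2) := Real.one_le_exp (by positivity)
        rw [abs_of_pos (Real.exp_pos _)]
        linarith
      calc |(z k - z i)⁻¹| * (1 + |z i|)
          ≤ (2 / (n ^ 2 * σ ^ 2))⁻¹ * (2 * Real.exp (2 / σ ^ 2)) :=
            mul_le_mul h1 h2 (by positivity) (by positivity)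
        _ = D * n ^ 2 := by
            rw [hD]
            field_simp
        _ ≤ Real.exp (D * n) * Real.exp n ^ 2 := by
            have h8 : D ≤ Real.exp (D * n) := by
              have h9 : 0 ≤ D := by positivity
              have := Real.add_one_le_exp (D * n)
              nlinarith
            have h10 : (n : ℝ) ≤ Real.exp n := by linarith [Real.add_one_le_exp (n : ℝ)]
            gcongr
        _ = Real.exp ((D + 2) * n) := by
            rw [← Real.exp_nat_mul, ← Real.exp_add]
            congr 1
            push_cast
            ring
    have hcoeff : ∑ j ∈ Finset.range n, |p.coeff j| ≤ Real.exp ((D + 2) * n ^ 2) := by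
      refine (sum_abs_coeff_prod_basisDivisor_le _ _ _ _).trans
        ((Finset.prod_le_prod (fun _ _ => by positivity) hfac).trans ?_)
      rw [Finset.prod_const, Finset.card_erase_of_mem hkmem, Finset.card_range, ← Real.exp_nat_mul]
      refine Real.exp_le_exp.mpr ?_
      have h1 : ((n - 1 : ℕ) : ℝ) ≤ n := by exact_mod_cast Nat.sub_le n 1
      have h2 : 0 ≤ (D + 2) * n := by positivity
      nlinarith
    have hterm : ∀ j : Fin n, |Real.exp (((k : ℕ) / n : ℝ) ^ 2 / σ ^ 2) *
        Real.exp (((j : ℕ) / n : ℝ) ^ 2 / σ ^ 2) * p.coeff j|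
        ≤ Real.exp (2 / σ ^ 2) * |p.coeff j| := fun j => by
      rw [abs_mul, abs_of_pos (by positivity), ← Real.exp_add]
      gcongr
      linarith [hnode k k.2, hnode j j.2, (by ring : 2 / σ ^ 2 = 1 / σ ^ 2 + 1 / σ ^ 2)]
    calc _ ≤ ∑ j : Fin n, Real.exp (2 / σ ^ 2) * |p.coeff j| :=
          Finset.sum_le_sum fun j _ => hterm j
      _ = Real.exp (2 / σ ^ 2) * ∑ j ∈ Finset.range n, |p.coeff j| := by
          rw [← Finset.mul_sum, Finset.sum_range]
      _ ≤ Real.exp (2 / σ ^ 2 * n ^ 2) * Real.exp ((D + 2) * n ^ 2) := by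
          refine mul_le_mul (Real.exp_le_exp.mpr ?_) hcoeff (by positivity) (by positivity)
          exact le_mul_of_one_le_right (by positivity) (one_le_pow₀ hn1)
      _ = _ := by
          rw [← Real.exp_add]
          congr 1
          ring

namespace SERKHS

/-- Fewer than `n ^ d` points cannot determine the functions of the space: there is a function
vanishing at these points which is not too small on the cube compared with its norm. -/
theorem exists_vanishing_of_card_lt (d : ℕ) {σ : ℝ} (hσ : 0 < σ) :
    ∃ Q > (0 : ℝ), ∀ n T : ℕ, T < n ^ d → ∀ x : Fin T → EuclideanSpace ℝ (Fin d),
      ∃ f : SERKHS d σ, (∀ τ, f (x τ) = 0) ∧ f ≠ 0 ∧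
        ∃ y : unitCube d, ‖f‖ ≤ Real.exp (Q * n ^ 2) * |f (y : EuclideanSpace ℝ (Fin d))| := by
  obtain ⟨Q, hQ, hdual⟩ := exists_dual_coefficients hσ
  -- Here `Q * d` comes from the norm of a tensor product of dual functions, and `d` from the `n ^
  -- d` summands; the extra `1` keeps the constant positive for `d = 0`.
  refine ⟨(1 + Q) * d + 1, by positivity, fun n T hT x => ?_⟩
  choose a ha hasum using hdual n
  set b : (Fin d → Fin n) → SERKHS d σ := fun k =>
    ∑ J : Fin d → Fin n, (∏ i, a (k i) (J i)) • kernelSection σ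
      (gridPoint J : EuclideanSpace ℝ (Fin d)) with hb
  have hbgrid : ∀ k m : Fin d → Fin n,
      b k (gridPoint m : EuclideanSpace ℝ (Fin d)) = if m = k then 1 else 0 := fun k m => by
    have h1 : b k (gridPoint m : EuclideanSpace ℝ (Fin d))
        = ∏ i, ∑ j, a (k i) j * seKernelReal σ ((m i : ℕ) / n : ℝ) ((j : ℕ) / n : ℝ) := by
      rw [Finset.prod_univ_sum, Fintype.piFinset_univ, hb, sum_apply]
      refine Finset.sum_congr rfl fun J _ => ?_
      rw [RKHS.coe_smul, Pi.smul_apply, kernelSection_apply, smul_eq_mul, gridPoint, gridPoint,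
        seKernel_toLp, Finset.prod_mul_distrib]
    rw [h1, Finset.prod_congr rfl fun i _ => ha (k i) (m i), Finset.prod_ite_zero]
    simp [funext_iff]
  have hbnorm : ∀ k, ‖b k‖ ≤ Real.exp (Q * n ^ 2) ^ d := fun k => by
    calc ‖b k‖ ≤ ∑ J : Fin d → Fin n, ∏ i, |a (k i) (J i)| := by
          refine (norm_sum_le _ _).trans (Finset.sum_le_sum fun J _ => ?_)
          rw [norm_smul, norm_kernelSection, mul_one, Real.norm_eq_abs, Finset.abs_prod]
      _ = ∏ i, ∑ j, |a (k i) j| := by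
          rw [Finset.prod_univ_sum, Fintype.piFinset_univ]
      _ ≤ ∏ _i : Fin d, Real.exp (Q * n ^ 2) :=
          Finset.prod_le_prod (fun _ _ => by positivity) fun i _ => hasum (k i)
      _ = _ := by simp
  -- There are `n ^ d` unknown coefficients and only `T` vanishing conditions.
  have hker : LinearMap.ker (Matrix.mulVecLin
      (Matrix.of fun (τ : Fin T) (k : Fin d → Fin n) => b k (x τ))) ≠ ⊥ :=
    LinearMap.ker_ne_bot_of_finrank_lt (by simpa using hT)
  obtain ⟨v, hv, hv0⟩ := (Submodule.ne_bot_iff _).mp hker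
  have hne : Nonempty (Fin d → Fin n) := by
    by_contra hemp
    rw [not_nonempty_iff] at hemp
    exact hv0 (Subsingleton.elim _ _)
  -- By duality the value at grid point `m` is `v m`, so the largest coefficient is attained as a
  -- function value and controls the norm.
  obtain ⟨m, hm⟩ := Finite.exists_max fun k => |v k|
  have hvm : v m ≠ 0 := fun h => hv0 <| funext fun k => by
    have := hm k
    rw [h, abs_zero] at this
    exact abs_nonpos_iff.mp this
  have hfapply : ∀ u, (∑ k, v k • b k) u = ∑ k, v k * b k u := fun u => by
    rw [sum_apply]
    exact Finset.sum_congr rfl fun k _ => by rw [RKHS.coe_smul, Pi.smul_apply, smul_eq_mul]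
  have hfm : (∑ k, v k • b k) (gridPoint m : EuclideanSpace ℝ (Fin d)) = v m := by
    rw [hfapply]
    simp [hbgrid]
  refine ⟨∑ k, v k • b k, fun τ => ?_, fun h0 => ?_, gridPoint m, ?_⟩
  · have h := congrFun (LinearMap.mem_ker.mp hv) τ
    rw [Matrix.mulVecLin_apply] at h
    rw [hfapply]
    refine Eq.trans (Finset.sum_congr rfl fun k _ => mul_comm _ _) h
  · rw [h0] at hfm
    exact hvm (by simpa using hfm.symm)
  · rw [hfm]
    have hn0 : (0 : ℝ) ≤ n := by positivity
    have h1 : (n : ℝ) ≤ Real.exp (n ^ 2) := by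
      have h2 : (n : ℝ) ≤ (n : ℝ) ^ 2 := by exact_mod_cast Nat.le_self_pow two_ne_zero n
      linarith [Real.add_one_le_exp ((n : ℝ) ^ 2)]
    calc ‖∑ k, v k • b k‖ ≤ ∑ _k : Fin d → Fin n, |v m| * Real.exp (Q * n ^ 2) ^ d := by
          refine (norm_sum_le _ _).trans (Finset.sum_le_sum fun k _ => ?_)
          rw [norm_smul, Real.norm_eq_abs]
          exact mul_le_mul (hm k) (hbnorm k) (norm_nonneg _) (abs_nonneg _)
      _ = (n : ℝ) ^ d * Real.exp (Q * n ^ 2) ^ d * |v m| := by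
          simp only [Finset.sum_const, Finset.card_univ, Fintype.card_pi, Fintype.card_fin,
            Finset.prod_const, nsmul_eq_mul, Nat.cast_pow]
          ring
      _ ≤ Real.exp (n ^ 2) ^ d * Real.exp (Q * n ^ 2) ^ d * |v m| := by gcongr
      _ = Real.exp ((1 + Q) * d * n ^ 2) * |v m| := by
          rw [← Real.exp_nat_mul, ← Real.exp_nat_mul, ← Real.exp_add]
          ring_nf
      _ ≤ _ := by
          gcongr
          linarith

end SERKHS

end

/-! ### Algorithms and the lower bound -/

noncomputable section

instance unitCube_nonempty (d : ℕ) : Nonempty (unitCube d) :=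
  ⟨⟨0, fun i => by simp⟩⟩

namespace DetAlgorithm

variable {X : Type}

theorem query_eq (A : DetAlgorithm X) (f : X → ℝ) (t : ℕ) :
    A.query f t = A.next t fun τ : Fin t => (A.query f τ, f (A.query f τ)) := by
  rw [DetAlgorithm.query]

/-- An algorithm cannot distinguish functions that agree at the points it evaluates. -/
theorem query_congr (A : DetAlgorithm X) {f g : X → ℝ} {T : ℕ}
    (h : ∀ τ < T, g (A.query f τ) = f (A.query f τ)) :
    ∀ t < T, A.query g t = A.query f t := by
  intro t
  induction t using Nat.strong_induction_on with
  | _ t ih =>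
    intro ht
    rw [query_eq A g, query_eq A f]
    congr 1
    funext τ
    have hτ := τ.2.trans ht
    rw [ih τ τ.2 hτ, h τ hτ]

end DetAlgorithm

namespace SERKHS

variable {d : ℕ} {σ : ℝ}

theorem bddBelow_range_onCube (f : SERKHS d σ) : BddBelow (Set.range f.onCube) :=
  ⟨-‖f‖, by
    rintro _ ⟨x, rfl⟩
    exact (abs_le.mp (abs_apply_le f x)).1⟩

/-- Such an `f` is indistinguishable from the zero function: the algorithm makes the same queries
and sees only zeros, so its regret is `-inf f`. -/
theorem neg_le_onCube_of_achievesRegret {R ε : ℝ} {A : DetAlgorithm (unitCube d)} {T : ℕ}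
    (hA : AchievesRegret σ R ε A T) {f : SERKHS d σ} (hR : ‖f‖ ≤ R)
    (hf : ∀ τ : Fin T, f (A.query (fun _ => 0) τ : EuclideanSpace ℝ (Fin d)) = 0)
    (y : unitCube d) : -ε ≤ f (y : EuclideanSpace ℝ (Fin d)) := by
  have hquery := A.query_congr (f := fun _ => 0) (g := f.onCube) (T := T) fun τ hτ => hf ⟨τ, hτ⟩
  have hzero : ∀ τ : Fin T, f.onCube (A.query f.onCube τ) = 0 := fun τ => by
    rw [hquery τ τ.2]
    exact hf τ
  have h1 := hA f hR
  -- For `T = 0` the infimum over the empty type is also `0`, by the convention for real infima.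
  simp only [simpleRegret, hzero, Real.iInf_const_zero] at h1
  have h2 : (⨅ x, f.onCube x) ≤ f.onCube y := ciInf_le f.bddBelow_range_onCube y
  have h3 : f.onCube y = f (y : EuclideanSpace ℝ (Fin d)) := rfl
  linarith

/-- If `T` evaluations suffice for regret `ε`, then `log (R / ε)` is at most quadratic in every
`n` with `T < n ^ d`. -/
theorem exists_log_le_of_achievesRegret (d : ℕ) {σ : ℝ} (hσ : 0 < σ) :
    ∃ Q > (0 : ℝ), ∀ R ε : ℝ, 0 < R → 0 < ε → ∀ (A : DetAlgorithm (unitCube d)) (T : ℕ),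
      AchievesRegret σ R ε A T → ∀ n : ℕ, T < n ^ d → Real.log (R / ε) ≤ Q * n ^ 2 := by
  obtain ⟨Q, hQ, hex⟩ := exists_vanishing_of_card_lt d hσ
  refine ⟨Q, hQ, fun R ε hR hε A T hA n hT => ?_⟩
  obtain ⟨g, hg, hg0, y, hy⟩ := hex n T hT fun τ => A.query (fun _ => 0) τ
  have hnorm : 0 < ‖g‖ := norm_pos_iff.mpr hg0
  have happly : ∀ (c : ℝ) (x : EuclideanSpace ℝ (Fin d)), (c • g) x = c * g x := fun c x => by
    rw [RKHS.coe_smul, Pi.smul_apply, smul_eq_mul]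
  have hbound : ∀ c : ℝ, |c| * ‖g‖ ≤ R → -ε ≤ c * g (y : EuclideanSpace ℝ (Fin d)) :=
    fun c hc => by
      rw [← happly]
      refine neg_le_onCube_of_achievesRegret hA (by rwa [norm_smul, Real.norm_eq_abs])
        (fun τ => ?_) y
      rw [happly, hg τ, mul_zero]
  have hc : |R / ‖g‖| * ‖g‖ ≤ R := by
    rw [abs_of_pos (by positivity), div_mul_cancel₀ _ hnorm.ne']
  have h1 := hbound (R / ‖g‖) hc
  -- Both signs are tried, since the sign of `g y` is unknown.
  have h2 := hbound (-(R / ‖g‖)) (by rwa [abs_neg])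
  have h3 : R / ‖g‖ * |g (y : EuclideanSpace ℝ (Fin d))| ≤ ε := by
    rw [← abs_of_pos (show 0 < R / ‖g‖ by positivity), ← abs_mul, abs_le]
    constructor <;> linarith
  have h4 : R ≤ Real.exp (Q * n ^ 2) * ε := by
    calc R = R / ‖g‖ * ‖g‖ := (div_mul_cancel₀ _ hnorm.ne').symm
      _ ≤ R / ‖g‖ * (Real.exp (Q * n ^ 2) * |g (y : EuclideanSpace ℝ (Fin d))|) := by gcongr
      _ = Real.exp (Q * n ^ 2) * (R / ‖g‖ * |g (y : EuclideanSpace ℝ (Fin d))|) := by ring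
      _ ≤ _ := by gcongr
  rw [Real.log_le_iff_le_exp (by positivity), div_le_iff₀ hε]
  exact h4

end SERKHS

theorem exists_evaluations_lower_bound (d : ℕ) {σ : ℝ} (hσ : 0 < σ) :
    ∃ c > (0 : ℝ), ∃ ρ > (1 : ℝ), ∀ R ε : ℝ, 0 < R → 0 < ε → ρ ≤ R / ε →
      ∀ (A : DetAlgorithm (unitCube d)) (T : ℕ), AchievesRegret σ R ε A T →
        c * Real.log (R / ε) ^ ((d : ℝ) / 2 - 1) ≤ (T : ℝ) := by
  obtain ⟨Q, hQ, hlog⟩ := SERKHS.exists_log_le_of_achievesRegret d hσ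
  -- With `r ^ 2 = L / (2 * Q)`, a floor `n ≤ r` gives `Q * n ^ 2 ≤ L / 2 < L`, contradicting `T < n
  -- ^ d`. Since `n ≥ r / 2` and `(r / 2) ^ 2 = L / (8 * Q)`, the constant follows. The threshold
  -- ensures `r ≥ 1`, and `L ≥ 1` for lowering the exponent at the end.
  refine ⟨((8 * Q)⁻¹) ^ ((d : ℝ) / 2), by positivity, Real.exp (1 + 2 * Q),
    Real.one_lt_exp_iff.mpr (by positivity), fun R ε hR hε hρ A T hA => ?_⟩
  set L := Real.log (R / ε) with hL
  have hL1 : 1 + 2 * Q ≤ L := (Real.le_log_iff_exp_le (by positivity)).mpr hρ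
  have hL0 : 0 < L := by linarith
  set r := √(L / (2 * Q)) with hr
  have hrsq : r ^ 2 = L / (2 * Q) := Real.sq_sqrt (by positivity)
  have hr1 : 1 ≤ r := by
    rw [hr, Real.one_le_sqrt, one_le_div (by positivity)]
    linarith
  set n := ⌊r⌋₊ with hn
  have hnr : (n : ℝ) ≤ r := Nat.floor_le (by linarith)
  have hn1 : (1 : ℝ) ≤ n := by exact_mod_cast (Nat.one_le_floor_iff r).mpr hr1
  have hrn : r / 2 ≤ n := by
    have := Nat.lt_floor_add_one r
    linarith
  have hT : n ^ d ≤ T := by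
    by_contra hlt
    have h1 := hlog R ε hR hε A T hA n (not_le.mp hlt)
    have h2 : (n : ℝ) ^ 2 ≤ L / (2 * Q) := by
      rw [← hrsq]
      exact pow_le_pow_left₀ (by positivity) hnr 2
    have h3 : Q * (n : ℝ) ^ 2 ≤ L / 2 := by
      calc Q * (n : ℝ) ^ 2 ≤ Q * (L / (2 * Q)) := by gcongr
        _ = L / 2 := by field_simp
    linarith
  have hpow : (r / 2) ^ d = ((8 * Q)⁻¹) ^ ((d : ℝ) / 2) * L ^ ((d : ℝ) / 2) := by
    have h1 : r / 2 = √((8 * Q)⁻¹ * L) := by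
      rw [eq_comm, Real.sqrt_eq_iff_eq_sq (by positivity) (by positivity), div_pow, hrsq]
      field_simp
      norm_num
    rw [h1, Real.sqrt_eq_rpow, ← Real.rpow_natCast, ← Real.rpow_mul (by positivity),
      ← Real.mul_rpow (by positivity) hL0.le]
    congr 1
    ring
  calc ((8 * Q)⁻¹) ^ ((d : ℝ) / 2) * L ^ ((d : ℝ) / 2 - 1)
      ≤ ((8 * Q)⁻¹) ^ ((d : ℝ) / 2) * L ^ ((d : ℝ) / 2) := by
        gcongr
        · linarith
        · linarith
    _ = (r / 2) ^ d := hpow.symm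
    _ ≤ (n : ℝ) ^ d := by gcongr
    _ ≤ T := by exact_mod_cast hT

/-! ### The interpolating algorithm and the upper bound -/

/-- The algorithm that evaluates the points `p 0, …, p (M - 1)` and then a `δ`-minimizer of some
function of the ball of radius `R` that agrees with all observations. -/
def interpolationAlgorithm {d : ℕ} (σ R δ : ℝ) {M : ℕ} (p : Fin M → unitCube d) :
    DetAlgorithm (unitCube d) where
  next t h := if ht : t < M then p ⟨t, ht⟩ else
    Classical.epsilon fun x => ∃ f : SERKHS d σ, ‖f‖ ≤ R ∧ (∀ τ, f.onCube (h τ).1 = (h τ).2) ∧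
      f.onCube x ≤ (⨅ y, f.onCube y) + δ

section interpolationAlgorithm

variable {d : ℕ} {σ R δ : ℝ} {M : ℕ} (p : Fin M → unitCube d)

theorem interpolationAlgorithm_query (f : unitCube d → ℝ) (t : Fin M) :
    (interpolationAlgorithm σ R δ p).query f t = p t := by
  rw [DetAlgorithm.query_eq]
  simp [interpolationAlgorithm]

/-- The condition defining the last query is satisfiable, as `f` itself agrees with its data; the
slack `δ` avoids the question whether the infimum is attained. -/
theorem exists_agreeing_near_minimizer (hδ : 0 < δ) {f : SERKHS d σ} (hf : ‖f‖ ≤ R) :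
    ∃ g : SERKHS d σ, ‖g‖ ≤ R ∧ (∀ t, g.onCube (p t) = f.onCube (p t)) ∧
      g.onCube ((interpolationAlgorithm σ R δ p).query f.onCube M)
        ≤ (⨅ y, g.onCube y) + δ := by
  have hex : ∃ x, ∃ g : SERKHS d σ, ‖g‖ ≤ R ∧ (∀ t, g.onCube (p t) = f.onCube (p t)) ∧
      g.onCube x ≤ (⨅ y, g.onCube y) + δ := by
    obtain ⟨x, hx⟩ := exists_lt_of_ciInf_lt (lt_add_of_pos_right (⨅ y, f.onCube y) hδ)
    exact ⟨x, f, hf, fun _ => rfl, hx.le⟩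
  have hquery : (interpolationAlgorithm σ R δ p).query f.onCube M
      = Classical.epsilon fun x => ∃ g : SERKHS d σ, ‖g‖ ≤ R ∧
        (∀ t, g.onCube (p t) = f.onCube (p t)) ∧ g.onCube x ≤ (⨅ y, g.onCube y) + δ := by
    rw [DetAlgorithm.query_eq]
    simp only [interpolationAlgorithm_query]
    simp [interpolationAlgorithm]
  rw [hquery]
  exact Classical.epsilon_spec hex

/-- If functions of norm at most `2 R` that vanish at the points `p` are bounded by `η` on the
cube, the algorithm has simple regret at most `2 η + δ`. -/
theorem achievesRegret_interpolationAlgorithm {η : ℝ} (hδ : 0 < δ)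
    (hη : ∀ g : SERKHS d σ, ‖g‖ ≤ 2 * R → (∀ t, g.onCube (p t) = 0) → ∀ x, |g.onCube x| ≤ η) :
    AchievesRegret σ R (2 * η + δ) (interpolationAlgorithm σ R δ p) (M + 1) := by
  intro f hf
  obtain ⟨g, hg, hagree, hmin⟩ := exists_agreeing_near_minimizer p hδ hf
  set x := (interpolationAlgorithm σ R δ p).query f.onCube M with hx
  have hsub : ∀ y, (f - g).onCube y = f.onCube y - g.onCube y := fun y => by
    simp [SERKHS.onCube]
  have hdiff : ∀ y, |f.onCube y - g.onCube y| ≤ η := fun y => by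
    rw [← hsub]
    exact hη (f - g) ((norm_sub_le f g).trans (by linarith))
      (fun t => by rw [hsub, hagree, sub_self]) y
  have h1 : (⨅ τ : Fin (M + 1), f.onCube ((interpolationAlgorithm σ R δ p).query f.onCube τ))
      ≤ f.onCube x := by
    have := ciInf_le (Set.finite_range fun τ : Fin (M + 1) =>
      f.onCube ((interpolationAlgorithm σ R δ p).query f.onCube τ)).bddBelow (Fin.last M)
    simpa using this
  have h2 : (⨅ y, g.onCube y) - η ≤ ⨅ y, f.onCube y := le_ciInf fun y => by
    have h3 : (⨅ y, g.onCube y) ≤ g.onCube y := ciInf_le g.bddBelow_range_onCube y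
    linarith [(abs_le.mp (hdiff y)).1]
  rw [simpleRegret]
  linarith [(abs_le.mp (hdiff x)).2]

end interpolationAlgorithm

theorem exists_grid_algorithm (d : ℕ) (σ : ℝ) :
    ∃ C > (0 : ℝ), ∃ ρ > (1 : ℝ), ∀ R ε : ℝ, 0 < R → 0 < ε → ρ ≤ R / ε →
      ∃ (A : DetAlgorithm (unitCube d)) (N T : ℕ), 1 ≤ N ∧ T = N ^ d + 1 ∧
        A.SamplesGridFirst N ∧ (T : ℝ) ≤ C * Real.log (R / ε) ^ d ∧
        AchievesRegret σ R ε A T := by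
  obtain ⟨C, hC, hsmall⟩ := SERKHS.exists_abs_apply_le_exp_neg d σ
  -- As `L ≥ 1`, `K * L ≥ log (6 * C) + L`. This makes `C * exp (-N) * (2 * R) ≤ ε / 3`, so with `η
  -- = δ = ε / 3` the regret `2 * η + δ` is `ε`.
  set K := 1 + Real.log (6 * C) with hK
  have hK1 : 1 ≤ K := by
    have : 0 ≤ Real.log (6 * C) := Real.log_nonneg (by linarith)
    linarith
  refine ⟨2 * (K + 1) ^ d, by positivity, Real.exp 1, Real.one_lt_exp_iff.mpr one_pos,
    fun R ε hR hε hρ => ?_⟩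
  set L := Real.log (R / ε) with hL
  have hL1 : 1 ≤ L := (Real.le_log_iff_exp_le (by positivity)).mpr hρ
  set N := ⌈K * L⌉₊ with hN
  have hKL : K * L ≤ N := Nat.le_ceil _
  have hN1 : 1 ≤ N := Nat.one_le_ceil_iff.mpr (by positivity)
  have hNle : (N : ℝ) ≤ (K + 1) * L := by
    have := Nat.ceil_lt_add_one (show 0 ≤ K * L by positivity)
    nlinarith
  set e : Fin (N ^ d) ≃ (Fin d → Fin N) := finFunctionFinEquiv.symm
  refine ⟨interpolationAlgorithm σ R (ε / 3) fun t => gridPoint (e t), N, N ^ d + 1, hN1, rfl,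
    ⟨e, fun t h => ?_⟩, ?_, ?_⟩
  · simp [interpolationAlgorithm]
  · have h1 : (1 : ℝ) ≤ (N : ℝ) ^ d := one_le_pow₀ (by exact_mod_cast hN1)
    have h2 : (N : ℝ) ^ d ≤ ((K + 1) * L) ^ d := pow_le_pow_left₀ (by positivity) hNle d
    rw [mul_pow] at h2
    push_cast
    linarith
  · have hexp : C * Real.exp (-N) * (2 * R) ≤ ε / 3 := by
      have h1 : Real.log (6 * C) + L ≤ N := by nlinarith
      have h2 : 6 * C * (R / ε) ≤ Real.exp N := by
        rw [← Real.log_le_iff_le_exp (by positivity),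
          Real.log_mul (by positivity) (by positivity)]
        exact h1
      have h3 : 6 * C * R ≤ Real.exp N * ε := by
        rwa [← mul_div_assoc, div_le_iff₀ hε] at h2
      calc C * Real.exp (-N) * (2 * R) = Real.exp (-N) * (6 * C * R) / 3 := by ring
        _ ≤ Real.exp (-N) * (Real.exp N * ε) / 3 := by gcongr
        _ = ε / 3 := by rw [← mul_assoc, ← Real.exp_add, neg_add_cancel, Real.exp_zero, one_mul]
    have h := achievesRegret_interpolationAlgorithm (σ := σ) (R := R) (δ := ε / 3) (η := ε / 3)
      (fun t => gridPoint (e t)) (by positivity) fun g hg hzero x => by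
        refine (hsmall N g (fun k => ?_) x).trans (le_trans ?_ hexp)
        · have := hzero (e.symm k)
          rwa [Equiv.apply_symm_apply] at this
        · exact mul_le_mul_of_nonneg_left hg (by positivity)
    rwa [show 2 * (ε / 3) + ε / 3 = ε by ring] at h

end

theorem theorem2 (d : ℕ) (hd : 0 < d) (σ : ℝ) (hσ : 0 < σ) :
    (∃ c > (0 : ℝ), ∃ ρ > (1 : ℝ), ∀ R ε : ℝ, 0 < R → 0 < ε → ρ ≤ R / ε →
      ∀ (A : DetAlgorithm (unitCube d)) (T : ℕ), 1 ≤ T → AchievesRegret σ R ε A T →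
        c * Real.log (R / ε) ^ ((d : ℝ) / 2 - 1) ≤ (T : ℝ)) ∧
    (∃ C > (0 : ℝ), ∃ ρ > (1 : ℝ), ∀ R ε : ℝ, 0 < R → 0 < ε → ρ ≤ R / ε →
      ∃ (A : DetAlgorithm (unitCube d)) (N T : ℕ), 1 ≤ N ∧ T = N ^ d + 1 ∧
        A.SamplesGridFirst N ∧ (T : ℝ) ≤ C * Real.log (R / ε) ^ d ∧
        AchievesRegret σ R ε A T) := by
  obtain ⟨c, hc, ρ, hρ, h⟩ := exists_evaluations_lower_bound d hσ
  exact ⟨⟨c, hc, ρ, hρ, fun R ε hR hε hRε A T _ => h R ε hR hε hRε A T⟩,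
    exists_grid_algorithm d σ⟩
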